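/- Let $\mathcal H=L^2(\mathbb R)$, let $\Omega=[0,1)\times[0,1)$, and let $Z:\mathcal H\to L^2(\Omega)$ be the Zak transform, i.e. the unitary map $$(Z\varphi)(\theta,\sigma)=\sum_{l\in\mathbb Z}\varphi(\sigma-l)e^{2\pi i l\theta}$$ (the series converging in $L^2(\Omega)$). For $x,y\in\mathbb R$ let $\rho(x,y)$ be the unitary operator $(\rho(x,y)\varphi)(t)=e^{\pi i(xy+2yt)}\varphi(t+x)$ on $\mathcal H$. Let $a\ge 1$ be an integer and $N=\mathbb Z\times a\mathbb Z$. A closed, densely defined operator $T$ on $\mathcal H$ is called $N$-periodic if $\rho(n)T\rho(n)^{-1}=T$ (including domains) for all $n\in N$. Let $\mathcal A_N$ be the von Neumann algebra of bounded $N$-periodic operators on $\mathcal H$, with the trace $$\tau(T)=\sum_{h=0}^{a-1}\langle T\chi_h,\chi_h\rangle,\qquad \chi_h=\chi_{[h/a,(h+1)/a)}.$$ Let $L^1(\mathcal A_N,\tau)$ be the set of closed, densely defined, $N$-periodic operators $T$ with $\tau(|T|)=\int_{[0,\infty)}\lambda\,d\tau(E_\lambda)<\infty$, where $|T|$ is the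 positive self-adjoint operator with $|T|^2=T^*T$ and $E$ is its spectral measure (which takes values in $\mathcal A_N$). Lemma 4.1. Let $g\in L^1(\Omega)$, let $\mathcal D_g=\{\varphi\in\mathcal H\mid gZ\varphi\in L^2(\Omega)\}$, and define $M_g:\mathcal D_g\to\mathcal H$ by $M_g\varphi=Z^{-1}(gZ\varphi)$. Then $\mathcal D_g$ is dense in $\mathcal H$, $M_g$ is closed, and $M_g$ is $N$-periodic. Moreover $M_g\in L^1(\mathcal A_N,\tau)$, and the distribution function of $M_g$ with respect to $\tau$ equals that of $g$: for every $\lambda>0$, $$\tau\bigl(\chi_{(\lambda,\infty)}(|M_g|)\bigr)=m\bigl(\{(\theta,\sigma)\in\Omega\mid |g(\theta,\sigma)|>\lambda\}\bigr),$$ where $m$ is Lebesgue measure and $\chi_{(\lambda,\infty)}(|M_g|)=E((\lambda,\infty))$ for the spectral measure $E$ of $|M_g|$. -/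

import Mathlib

open MeasureTheory Set Filter
open scoped ENNReal InnerProductSpace

namespace ZakMultiplier

noncomputable section

/-- The Hilbert space `L²(ℝ)`. -/
abbrev L2R : Type := Lp ℂ 2 (volume : Measure ℝ)

/-- The unit square `[0,1) × [0,1)`; points are written `(θ, σ)`. -/
def unitSquare : Set (ℝ × ℝ) := Ico 0 1 ×ˢ Ico 0 1

/-- Lebesgue measure on the unit square. -/
def squareMeasure : Measure (ℝ × ℝ) := volume.restrict unitSquare

/-- The Hilbert space `L²` of the unit square. -/
abbrev L2Square : Type := Lp ℂ 2 squareMeasure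

/-! ### The Zak transform -/

/-- The `l`-th term `φ(σ - l) e^{2πilθ}` of the Zak series, as a function of `p = (θ, σ)`. -/
def zakTermFun (l : ℤ) (φ : ℝ → ℂ) (p : ℝ × ℝ) : ℂ :=
  φ (p.2 - l) * Complex.exp (2 * Real.pi * Complex.I * l * p.1)

theorem squareMeasure_eq_prod :
    squareMeasure = ((volume : Measure ℝ).restrict (Ico 0 1)).prod
      ((volume : Measure ℝ).restrict (Ico 0 1)) := by
  rw [squareMeasure, unitSquare, Measure.prod_restrict, Measure.volume_eq_prod]

theorem norm_exp_term (l : ℤ) (x : ℝ) :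
    ‖Complex.exp (2 * Real.pi * Complex.I * l * x)‖ = 1 := by
  have : (2 * Real.pi * Complex.I * l * x : ℂ) = ((2 * Real.pi * l * x : ℝ) : ℂ) * Complex.I := by
    push_cast; ring
  rw [this, Complex.norm_exp_ofReal_mul_I]

instance : IsProbabilityMeasure ((volume : Measure ℝ).restrict (Ico 0 1)) :=
  ⟨by simp⟩

instance : IsProbabilityMeasure squareMeasure := by
  rw [squareMeasure_eq_prod]; infer_instance

theorem qmp_shift (l : ℤ) :
    Measure.QuasiMeasurePreserving (fun p : ℝ × ℝ => p.2 - (l : ℝ)) squareMeasure volume := by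
  rw [squareMeasure_eq_prod]
  have h1 : Measure.QuasiMeasurePreserving (Prod.snd : ℝ × ℝ → ℝ)
      (((volume : Measure ℝ).restrict (Ico 0 1)).prod ((volume : Measure ℝ).restrict (Ico 0 1)))
      volume :=
    Measure.quasiMeasurePreserving_snd.mono_right Measure.absolutelyContinuous_restrict
  exact (measurePreserving_sub_right volume (l : ℝ)).quasiMeasurePreserving.comp h1

theorem memLp_zakTermFun (l : ℤ) {φ : ℝ → ℂ} (hφ : MemLp φ 2 volume) :
    MemLp (zakTermFun l φ) 2 squareMeasure := by
  have h1 : MemLp (fun σ : ℝ => φ (σ - l)) 2 ((volume : Measure ℝ).restrict (Ico 0 1)) :=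
    (hφ.comp_measurePreserving (measurePreserving_sub_right volume (l : ℝ))).restrict _
  have h2 : MemLp (fun p : ℝ × ℝ => φ (p.2 - l)) 2 squareMeasure := by
    rw [squareMeasure_eq_prod]
    exact h1.comp_measurePreserving measurePreserving_snd
  refine h2.congr_norm ?_ ?_
  · refine h2.aestronglyMeasurable.mul ?_
    exact (by fun_prop : Continuous fun p : ℝ × ℝ =>
      Complex.exp (2 * Real.pi * Complex.I * l * p.1)).aestronglyMeasurable
  · filter_upwards with p
    simp [zakTermFun, norm_exp_term]

/-- The `l`-th term of the Zak series as a linear map `L²(ℝ) → L²([0,1)²)`. -/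
def zakTerm (l : ℤ) : L2R →ₗ[ℂ] L2Square where
  toFun φ := (memLp_zakTermFun l (Lp.memLp φ)).toLp _
  map_add' φ ψ := by
    rw [← MemLp.toLp_add, MemLp.toLp_eq_toLp_iff]
    filter_upwards [(qmp_shift l).ae_eq_comp (Lp.coeFn_add φ ψ)] with p hp
    simp only [Function.comp_apply] at hp
    change (φ + ψ : L2R) (p.2 - l) * _ = φ (p.2 - l) * _ + ψ (p.2 - l) * _
    rw [hp, Pi.add_apply, add_mul]
  map_smul' c φ := by
    rw [RingHom.id_apply, ← MemLp.toLp_const_smul, MemLp.toLp_eq_toLp_iff]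
    filter_upwards [(qmp_shift l).ae_eq_comp (Lp.coeFn_smul c φ)] with p hp
    simp only [Function.comp_apply] at hp
    change (c • φ : L2R) (p.2 - l) * _ = c • (φ (p.2 - l) * _)
    rw [hp, Pi.smul_apply, smul_mul_assoc]

theorem coeFn_zakTerm (l : ℤ) (φ : L2R) :
    zakTerm l φ =ᵐ[squareMeasure] zakTermFun l φ :=
  MemLp.coeFn_toLp (memLp_zakTermFun l (Lp.memLp φ))

theorem integral_exp_term (k : ℤ) :
    ∫ x in Ico (0 : ℝ) 1, Complex.exp (2 * Real.pi * Complex.I * k * x) = if k = 0 then 1 else 0 := by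
  split_ifs with h
  · simp [h]
  · rw [integral_Ico_eq_integral_Ioc, ← intervalIntegral.integral_of_le zero_le_one]
    have hc : (2 * Real.pi * Complex.I * k : ℂ) ≠ 0 := by
      simp [h, Real.pi_ne_zero]
    rw [integral_exp_mul_complex hc]
    have : Complex.exp (2 * Real.pi * Complex.I * k) = 1 := by
      rw [Complex.exp_eq_one_iff]; exact ⟨k, by ring⟩
    simp [this]

theorem inner_zakTerm (l m : ℤ) (φ ψ : L2R) :
    ⟪zakTerm l φ, zakTerm m ψ⟫_ℂ =
      (if m = l then 1 else 0) *
        ∫ σ in Ico (0 : ℝ) 1, ψ (σ - m) * (starRingEnd ℂ) (φ (σ - l)) := by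
  rw [L2.inner_def]
  have h1 : (fun p => ⟪zakTerm l φ p, zakTerm m ψ p⟫_ℂ) =ᵐ[squareMeasure]
      fun p : ℝ × ℝ => Complex.exp (2 * Real.pi * Complex.I * ((m - l : ℤ) : ℂ) * p.1) *
        (ψ (p.2 - m) * (starRingEnd ℂ) (φ (p.2 - l))) := by
    filter_upwards [coeFn_zakTerm l φ, coeFn_zakTerm m ψ] with p hp hq
    rw [hp, hq]
    simp only [zakTermFun, RCLike.inner_apply, map_mul, ← Complex.exp_conj, Complex.conj_I,
      Complex.conj_ofReal, map_ofNat, Int.cast_sub, map_intCast]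
    rw [show (2 * Real.pi * Complex.I * ((m : ℂ) - l) * p.1 : ℂ) =
      2 * Real.pi * Complex.I * m * p.1 + 2 * Real.pi * (-Complex.I) * l * p.1 by ring,
      Complex.exp_add]
    ring
  rw [integral_congr_ae h1, squareMeasure_eq_prod, integral_prod_mul
    (fun x : ℝ => Complex.exp (2 * Real.pi * Complex.I * ((m - l : ℤ) : ℂ) * x))
    (fun y : ℝ => ψ (y - m) * (starRingEnd ℂ) (φ (y - l))), integral_exp_term]
  simp [sub_eq_zero]

theorem orthogonalFamily_zakTerm :
    OrthogonalFamily ℂ (fun l : ℤ => LinearMap.range (zakTerm l))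
      (fun l => (LinearMap.range (zakTerm l)).subtypeₗᵢ) := by
  rintro l m hlm ⟨_, φ, rfl⟩ ⟨_, ψ, rfl⟩
  simp [inner_zakTerm, hlm.symm]

theorem hasSum_norm_sq_zakTerm (φ : L2R) :
    HasSum (fun l : ℤ => ‖zakTerm l φ‖ ^ 2) (‖φ‖ ^ 2) := by
  have hi : Integrable (fun x => ‖φ x‖ ^ 2) volume := (Lp.memLp φ).integrable_norm_pow two_ne_zero
  have h := hi.hasSum_intervalIntegral_comp_add_int
  rw [← (Equiv.neg ℤ).hasSum_iff] at h
  have h0 : ‖φ‖ ^ 2 = ∫ x, ‖φ x‖ ^ 2 := by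
    have := inner_self_eq_norm_sq_to_K (𝕜 := ℂ) φ
    rw [L2.inner_def] at this
    simp only [inner_self_eq_norm_sq_to_K] at this
    have h3 : (∫ a, ((‖φ a‖ : ℂ)) ^ 2) = ((∫ x, ‖φ x‖ ^ 2 : ℝ) : ℂ) := by
      rw [← integral_complex_ofReal]; simp
    have h4 : (∫ a, ((‖φ a‖ : ℂ)) ^ 2) = (‖φ‖ : ℂ) ^ 2 := this
    rw [h3] at h4
    exact_mod_cast h4.symm
  rw [h0]
  convert! h using 2 with l
  have h1 := inner_zakTerm l l φ φ
  have h2 : ‖zakTerm l φ‖ ^ 2 = RCLike.re ⟪zakTerm l φ, zakTerm l φ⟫_ℂ := norm_sq_eq_re_inner _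
  rw [h2, h1]
  simp only [if_true, one_mul, Complex.mul_conj, Function.comp_apply, Equiv.neg_apply,
    Int.cast_neg, ← sub_eq_add_neg]
  rw [integral_complex_ofReal, intervalIntegral.integral_of_le zero_le_one,
    ← integral_Ico_eq_integral_Ioc]
  simp [Complex.normSq_eq_norm_sq]

theorem summable_zakTerm (φ : L2R) : Summable fun l : ℤ => zakTerm l φ :=
  (orthogonalFamily_zakTerm.summable_iff_norm_sq_summable
    (fun l => ⟨zakTerm l φ, φ, rfl⟩)).2 (hasSum_norm_sq_zakTerm φ).summable

/-- The Zak transform `(Zφ)(θ, σ) = ∑_{l ∈ ℤ} φ(σ - l) e^{2πilθ}`, as an isometry; for general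
`φ ∈ L²(ℝ)` the series converges in `L²([0,1)²)`. -/
def zakIsometry : L2R →ₗᵢ[ℂ] L2Square where
  toFun φ := ∑' l : ℤ, zakTerm l φ
  map_add' φ ψ := by
    simp only [map_add]
    exact (summable_zakTerm φ).tsum_add (summable_zakTerm ψ)
  map_smul' c φ := by
    simp only [map_smul, RingHom.id_apply]
    exact (summable_zakTerm φ).tsum_const_smul c
  norm_map' φ := by
    have h1 : Tendsto (fun s : Finset ℤ => ‖∑ l ∈ s, zakTerm l φ‖ ^ 2) atTop
        (nhds (‖∑' l : ℤ, zakTerm l φ‖ ^ 2)) := ((summable_zakTerm φ).hasSum.norm).pow 2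
    have h2 : ∀ s : Finset ℤ, ‖∑ l ∈ s, zakTerm l φ‖ ^ 2 = ∑ l ∈ s, ‖zakTerm l φ‖ ^ 2 :=
      fun s => orthogonalFamily_zakTerm.norm_sum (fun l => ⟨zakTerm l φ, φ, rfl⟩) s
    simp only [h2] at h1
    have h3 := tendsto_nhds_unique h1 (hasSum_norm_sq_zakTerm φ)
    exact (sq_eq_sq₀ (norm_nonneg _) (norm_nonneg _)).1 h3

theorem zakIsometry_apply (φ : L2R) : zakIsometry φ = ∑' l : ℤ, zakTerm l φ := rfl

/-- A function in `L²([0,1)²)` orthogonal to all `e^{2πilθ} f(σ)` vanishes. -/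
theorem ae_eq_zero_of_orthogonal (F : ℝ × ℝ → ℂ) (hF0 : MemLp F 2 squareMeasure)
    (hF : ∀ (l : ℤ) (s : Set ℝ), MeasurableSet s →
      ∫ p, Complex.exp (2 * Real.pi * Complex.I * l * p.1) *
        (s.indicator (fun _ => (1 : ℂ)) p.2 * (starRingEnd ℂ) (F p)) ∂squareMeasure = 0) :
    F =ᵐ[squareMeasure] 0 := by
  set ν : Measure ℝ := (volume : Measure ℝ).restrict (Ico 0 1) with hν
  have hF2 : MemLp F 2 (ν.prod ν) := by
    rw [hν, ← squareMeasure_eq_prod]; exact hF0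
  have hc : MemLp (fun p : ℝ × ℝ => (starRingEnd ℂ) (F p)) 2 (ν.prod ν) :=
    hF2.congr_norm (Complex.continuous_conj.comp_aestronglyMeasurable hF2.aestronglyMeasurable)
      (by simp)
  have hci : Integrable (fun p : ℝ × ℝ => (starRingEnd ℂ) (F p)) (ν.prod ν) :=
    hc.integrable (by norm_num)
  have hGi : ∀ l : ℤ, Integrable (fun p : ℝ × ℝ =>
      Complex.exp (2 * Real.pi * Complex.I * l * p.1) * (starRingEnd ℂ) (F p)) (ν.prod ν) := by
    intro l
    refine hci.bdd_mul (c := 1) ?_ ?_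
    · exact (by fun_prop : Continuous fun p : ℝ × ℝ =>
        Complex.exp (2 * Real.pi * Complex.I * l * p.1)).aestronglyMeasurable
    · filter_upwards with p
      simp [norm_exp_term]
  have hl : ∀ l : ℤ, ∀ᵐ σ ∂ν,
      ∫ θ, Complex.exp (2 * Real.pi * Complex.I * l * θ) * (starRingEnd ℂ) (F (θ, σ)) ∂ν = 0 := by
    intro l
    refine Integrable.ae_eq_zero_of_forall_setIntegral_eq_zero (hGi l).integral_prod_right ?_
    intro s hs _
    have h1 := hF l s hs
    rw [squareMeasure_eq_prod, ← hν] at h1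
    have h2 : (fun p : ℝ × ℝ => Complex.exp (2 * Real.pi * Complex.I * l * p.1) *
        (s.indicator (fun _ => (1 : ℂ)) p.2 * (starRingEnd ℂ) (F p))) =
        (Prod.snd ⁻¹' s).indicator (fun p : ℝ × ℝ =>
          Complex.exp (2 * Real.pi * Complex.I * l * p.1) * (starRingEnd ℂ) (F p)) := by
      ext p
      by_cases hp : p.2 ∈ s
      · simp [hp]
      · simp [hp]
    rw [h2, integral_prod_symm _ ((hGi l).indicator (measurable_snd hs))] at h1
    rw [← integral_indicator hs, ← h1]
    refine integral_congr_ae (ae_of_all _ fun σ => ?_)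
    by_cases hσ : σ ∈ s
    · simp [hσ, indicator]
    · simp [hσ, indicator]
  have hsq : Integrable (fun p : ℝ × ℝ => ‖F p‖ ^ 2) (ν.prod ν) :=
    hF2.integrable_norm_pow two_ne_zero
  have hz : ∀ᵐ σ ∂ν, ∫ θ, ‖F (θ, σ)‖ ^ 2 ∂ν = 0 := by
    filter_upwards [ae_all_iff.2 hl, hsq.prod_left_ae, hci.prod_left_ae] with σ h1 h2 h3
    have h4 : MemLp (fun θ => (starRingEnd ℂ) (F (θ, σ))) 2 (volume.restrict (Ioc (0 : ℝ) 1)) := by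
      rw [← restrict_Ico_eq_restrict_Ioc, ← hν, memLp_two_iff_integrable_sq_norm h3.1]
      simpa using h2
    have h5 := hasSum_sq_fourierCoeffOn zero_lt_one h4
    have h6 : ∀ n : ℤ, fourierCoeffOn zero_lt_one (fun θ => (starRingEnd ℂ) (F (θ, σ))) n = 0 := by
      intro n
      rw [fourierCoeffOn_eq_integral, intervalIntegral.integral_of_le zero_le_one,
        ← integral_Ico_eq_integral_Ioc, ← hν]
      convert! smul_zero _ using 2
      rw [← h1 (-n)]
      refine integral_congr_ae (ae_of_all _ fun θ => ?_)
      have h10 : fourier (-n) ((θ : ℝ) : AddCircle ((1 : ℝ) - 0)) =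
          Complex.exp (2 * Real.pi * Complex.I * ((-n : ℤ) : ℂ) * θ) := by
        rw [fourier_coe_apply]; simp
      simp only [h10, smul_eq_mul]
    simp only [h6] at h5
    have h7 := h5.unique (by simp : HasSum _ (0 : ℝ))
    rw [intervalIntegral.integral_of_le zero_le_one, ← integral_Ico_eq_integral_Ioc, ← hν] at h7
    simpa using h7
  have h8 : ∫ p, ‖F p‖ ^ 2 ∂(ν.prod ν) = 0 := by
    rw [integral_prod_symm _ hsq]
    exact integral_eq_zero_of_ae hz
  rw [integral_eq_zero_iff_of_nonneg (fun p => by positivity) hsq] at h8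
  rw [squareMeasure_eq_prod, ← hν]
  filter_upwards [h8] with p hp
  simpa using hp

theorem surjective_zakIsometry : Function.Surjective zakIsometry := by
  have hcl : IsClosed (LinearMap.range zakIsometry.toLinearMap : Set L2Square) := by
    have := zakIsometry.isometry.isClosedEmbedding.isClosed_range
    exact this
  have : CompleteSpace (LinearMap.range zakIsometry.toLinearMap) := hcl.completeSpace_coe
  rw [← LinearIsometry.coe_toLinearMap, ← LinearMap.range_eq_top,
    ← Submodule.orthogonal_eq_bot_iff, Submodule.eq_bot_iff]
  intro F hF
  rw [Submodule.mem_orthogonal] at hF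
  rw [Lp.eq_zero_iff_ae_eq_zero]
  refine ae_eq_zero_of_orthogonal F (Lp.memLp F) fun l s hs => ?_
  have hsI : MeasurableSet (s ∩ Ico (0 : ℝ) 1) := hs.inter measurableSet_Ico
  have hf : MemLp ((s ∩ Ico (0 : ℝ) 1).indicator (fun _ => (1 : ℂ))) 2 volume :=
    memLp_indicator_const 2 hsI 1 (Or.inr (measure_inter_lt_top_of_right_ne_top (by simp)).ne)
  have hφ := hf.comp_measurePreserving (measurePreserving_add_right volume (l : ℝ))
  set φ : L2R := hφ.toLp _ with hφd
  have hterm : ∀ m : ℤ, zakTerm m φ =ᵐ[squareMeasure] fun p => if m = l then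
      Complex.exp (2 * Real.pi * Complex.I * l * p.1) * s.indicator (fun _ => (1 : ℂ)) p.2
      else 0 := by
    intro m
    have hp3 : ∀ᵐ p ∂squareMeasure, p ∈ unitSquare :=
      ae_restrict_mem (measurableSet_Ico.prod measurableSet_Ico)
    filter_upwards [coeFn_zakTerm m φ, (qmp_shift m).ae_eq_comp hφ.coeFn_toLp, hp3]
      with p hp1 hp2 hp3
    rw [hp1, zakTermFun]
    simp only [Function.comp_apply] at hp2
    rw [hφd, hp2]
    have hσ : p.2 ∈ Ico (0 : ℝ) 1 := hp3.2
    split_ifs with h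
    · subst h
      by_cases hs' : p.2 ∈ s
      · simp [indicator, hs', hσ.1, hσ.2]
      · simp [indicator, hs']
    · have : p.2 - m + l ∉ Ico (0 : ℝ) 1 := by
        intro h'
        apply h
        have h1 : (m : ℝ) < l + 1 := by linarith [h'.1, hσ.2]
        have h2 : (l : ℝ) < m + 1 := by linarith [h'.2, hσ.1]
        have h1' : m < l + 1 := by exact_mod_cast h1
        have h2' : l < m + 1 := by exact_mod_cast h2
        omega
      simp [indicator, this]
  have hZ : zakIsometry φ = zakTerm l φ := by
    rw [zakIsometry_apply]
    refine tsum_eq_single l fun m hm => ?_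
    rw [Lp.eq_zero_iff_ae_eq_zero]
    filter_upwards [hterm m] with p hp
    simp [hp, hm]
  have h0 := inner_eq_zero_symm.1 (hF (zakIsometry φ) ⟨φ, rfl⟩)
  rw [hZ, L2.inner_def] at h0
  rw [← h0]
  refine integral_congr_ae ?_
  filter_upwards [hterm l] with p hp
  rw [hp]
  simp [mul_assoc]

/-- The Zak transform as a unitary map `L²(ℝ) → L²([0,1)²)`. -/
def zak : L2R ≃ₗᵢ[ℂ] L2Square :=
  LinearIsometryEquiv.ofSurjective zakIsometry surjective_zakIsometry

/-- The Zak transform is given by the series `∑_{l ∈ ℤ} φ(σ - l) e^{2πilθ}`. -/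
theorem hasSum_zak (φ : L2R) : HasSum (fun l : ℤ => zakTerm l φ) (zak φ) :=
  (summable_zakTerm φ).hasSum


/-! ### The Zak multiplier -/

/-- The domain `{φ ∈ L²(ℝ) | g · Zφ ∈ L²([0,1)²)}`. -/
def zakMultiplierDomain (g : ℝ × ℝ → ℂ) : Submodule ℂ L2R where
  carrier := {φ | MemLp (fun p => g p * zak φ p) 2 squareMeasure}
  add_mem' := by
    intro φ ψ hφ hψ
    refine (MemLp.add hφ hψ).ae_eq ?_
    rw [map_add]
    filter_upwards [Lp.coeFn_add (zak φ) (zak ψ)] with p hp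
    rw [hp]
    simp [mul_add]
  zero_mem' := by
    refine (MemLp.zero (p := 2) (μ := squareMeasure) (ε := ℂ)).ae_eq ?_
    rw [map_zero]
    filter_upwards [Lp.coeFn_zero ℂ 2 squareMeasure] with p hp
    rw [hp]
    simp
  smul_mem' := by
    intro c φ hφ
    refine (MemLp.const_smul hφ c).ae_eq ?_
    rw [map_smul]
    filter_upwards [Lp.coeFn_smul c (zak φ)] with p hp
    rw [hp, Pi.smul_apply, Pi.smul_apply, smul_eq_mul, smul_eq_mul, mul_left_comm]

theorem mem_zakMultiplierDomain {g : ℝ × ℝ → ℂ} {φ : L2R} :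
    φ ∈ zakMultiplierDomain g ↔ MemLp (fun p => g p * zak φ p) 2 squareMeasure := Iff.rfl

/-- Multiplication by `g` after the Zak transform, `φ ↦ g · Zφ`, on its natural domain. -/
def mulZak (g : ℝ × ℝ → ℂ) : zakMultiplierDomain g →ₗ[ℂ] L2Square where
  toFun φ := MemLp.toLp (fun p => g p * zak φ.1 p) (mem_zakMultiplierDomain.1 φ.2)
  map_add' φ ψ := by
    rw [← MemLp.toLp_add, MemLp.toLp_eq_toLp_iff]
    have h : zak (φ + ψ : zakMultiplierDomain g).1 = zak φ.1 + zak ψ.1 := map_add zak φ.1 ψ.1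
    rw [h]
    filter_upwards [Lp.coeFn_add (zak φ.1) (zak ψ.1)] with p hp
    rw [hp]
    simp [mul_add]
  map_smul' c φ := by
    rw [RingHom.id_apply, ← MemLp.toLp_const_smul, MemLp.toLp_eq_toLp_iff]
    have h : zak (c • φ : zakMultiplierDomain g).1 = c • zak φ.1 := map_smul zak c φ.1
    rw [h]
    filter_upwards [Lp.coeFn_smul c (zak φ.1)] with p hp
    rw [hp, Pi.smul_apply, Pi.smul_apply, smul_eq_mul, smul_eq_mul, mul_left_comm]

/-- The Zak multiplier `M_g φ = Z⁻¹(g · Zφ)` with domain `{φ ∈ L²(ℝ) | g · Zφ ∈ L²([0,1)²)}`. -/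
def zakMultiplier (g : ℝ × ℝ → ℂ) : L2R →ₗ.[ℂ] L2R where
  domain := zakMultiplierDomain g
  toFun := zak.symm.toLinearEquiv.toLinearMap ∘ₗ mulZak g

/-! ### The Heisenberg representation and periodic operators -/

/-- The function `t ↦ e^{πi(xy + 2yt)} φ(t + x)`. -/
def heisFun (x y : ℝ) (φ : ℝ → ℂ) (t : ℝ) : ℂ :=
  Complex.exp (Real.pi * Complex.I * (x * y + 2 * y * t)) * φ (t + x)

theorem norm_heisFun (x y : ℝ) (φ : ℝ → ℂ) (t : ℝ) : ‖heisFun x y φ t‖ = ‖φ (t + x)‖ := by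
  have : (Real.pi * Complex.I * (x * y + 2 * y * t) : ℂ) =
    ((Real.pi * (x * y + 2 * y * t) : ℝ) : ℂ) * Complex.I := by push_cast; ring
  rw [heisFun, this, norm_mul, Complex.norm_exp_ofReal_mul_I, one_mul]

theorem memLp_heisFun (x y : ℝ) {φ : ℝ → ℂ} (hφ : MemLp φ 2 volume) :
    MemLp (heisFun x y φ) 2 volume := by
  have h2 := hφ.comp_measurePreserving (measurePreserving_add_right volume x)
  refine h2.congr_norm ?_ ?_
  · refine AEStronglyMeasurable.mul ?_ h2.aestronglyMeasurable
    exact (by fun_prop : Continuous fun t : ℝ =>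
      Complex.exp (Real.pi * Complex.I * (x * y + 2 * y * t))).aestronglyMeasurable
  · filter_upwards with t
    rw [norm_heisFun, Function.comp_apply]

theorem ae_shift (x : ℝ) {f g : ℝ → ℂ} (h : f =ᵐ[volume] g) :
    (fun t => f (t + x)) =ᵐ[volume] fun t => g (t + x) :=
  (measurePreserving_add_right volume x).quasiMeasurePreserving.ae_eq_comp h

/-- The operator `(ρ(x, y, 1)φ)(t) = e^{πi(xy + 2yt)} φ(t + x)` as a linear map. -/
def heisLinear (x y : ℝ) : L2R →ₗ[ℂ] L2R where
  toFun φ := (memLp_heisFun x y (Lp.memLp φ)).toLp _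
  map_add' φ ψ := by
    rw [← MemLp.toLp_add, MemLp.toLp_eq_toLp_iff]
    filter_upwards [ae_shift x (Lp.coeFn_add φ ψ)] with t ht
    change _ * (φ + ψ : L2R) (t + x) = _ * φ (t + x) + _ * ψ (t + x)
    rw [ht, Pi.add_apply, mul_add]
  map_smul' c φ := by
    rw [RingHom.id_apply, ← MemLp.toLp_const_smul, MemLp.toLp_eq_toLp_iff]
    filter_upwards [ae_shift x (Lp.coeFn_smul c φ)] with t ht
    change _ * (c • φ : L2R) (t + x) = c • (_ * φ (t + x))
    rw [ht, Pi.smul_apply, mul_smul_comm]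

theorem heisLinear_neg_comp (x y : ℝ) (φ : L2R) :
    heisLinear (-x) (-y) (heisLinear x y φ) = φ := by
  apply Lp.ext
  have h1 : heisLinear x y φ =ᵐ[volume] heisFun x y φ :=
    MemLp.coeFn_toLp (memLp_heisFun x y (Lp.memLp φ))
  have h2 : heisLinear (-x) (-y) (heisLinear x y φ) =ᵐ[volume]
      heisFun (-x) (-y) (heisLinear x y φ) :=
    MemLp.coeFn_toLp (memLp_heisFun (-x) (-y) (Lp.memLp _))
  filter_upwards [h2, ae_shift (-x) h1] with t ht1 ht2
  rw [ht1, heisFun, ht2, heisFun, ← mul_assoc, ← Complex.exp_add]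
  have : (Real.pi * Complex.I * (((-x : ℝ) : ℂ) * ((-y : ℝ) : ℂ) + 2 * ((-y : ℝ) : ℂ) * t) +
      Real.pi * Complex.I * (x * y + 2 * y * ((t + -x : ℝ) : ℂ)) : ℂ) = 0 := by
    push_cast; ring
  rw [this]
  simp

/-- The unitary operator `ρ(w) = ρ(x, y, 1)`, `w = (x, y)`, of the Heisenberg representation,
`(ρ(x, y, 1)φ)(t) = e^{πi(xy + 2yt)} φ(t + x)`. -/
def heis (w : ℝ × ℝ) : L2R ≃ₗᵢ[ℂ] L2R where
  toLinearEquiv := LinearEquiv.ofLinearMap (heisLinear w.1 w.2) (heisLinear (-w.1) (-w.2))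
    (by ext1 φ; simpa using heisLinear_neg_comp (-w.1) (-w.2) φ)
    (by ext1 φ; exact heisLinear_neg_comp w.1 w.2 φ)
  norm_map' φ := by
    change ‖(memLp_heisFun w.1 w.2 (Lp.memLp φ)).toLp _‖ = ‖φ‖
    rw [Lp.norm_toLp, Lp.norm_def]
    congr 1
    rw [← eLpNorm_comp_measurePreserving (Lp.memLp φ).aestronglyMeasurable
      (measurePreserving_add_right volume w.1)]
    exact eLpNorm_congr_norm_ae (ae_of_all _ fun t => norm_heisFun _ _ _ _)

theorem coeFn_heis (w : ℝ × ℝ) (φ : L2R) : heis w φ =ᵐ[volume] heisFun w.1 w.2 φ :=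
  MemLp.coeFn_toLp (memLp_heisFun w.1 w.2 (Lp.memLp φ))

/-- The lattice `N = ℤ × aℤ` in `ℝ²`. -/
def lattice (a : ℕ) : Set (ℝ × ℝ) := {w | ∃ m n : ℤ, w = ((m : ℝ), (a : ℝ) * n)}

/-- The partial operator `U T U⁻¹`, for a unitary `U`, on its natural domain `U (dom T)`. -/
def conjugate (U : L2R ≃ₗᵢ[ℂ] L2R) (T : L2R →ₗ.[ℂ] L2R) : L2R →ₗ.[ℂ] L2R where
  domain := T.domain.comap U.symm.toLinearEquiv.toLinearMap
  toFun := U.toLinearEquiv.toLinearMap ∘ₗ T.toFun ∘ₗ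
    (U.symm.toLinearEquiv.toLinearMap.restrict fun _ hx => hx)

/-- A closed densely defined operator `T` on `L²(ℝ)` is `N`-periodic, `N = ℤ × aℤ`, if
`ρ(n, 1) T ρ(n, 1)⁻¹ = T` (equality of partially defined operators) for all `n ∈ N`. -/
structure IsPeriodic (a : ℕ) (T : L2R →ₗ.[ℂ] L2R) : Prop where
  dense_domain : Dense (T.domain : Set L2R)
  isClosed : T.IsClosed
  conjugate_eq : ∀ n ∈ lattice a, conjugate (heis n) T = T

/-- The operators `ρ(n, 1)`, `n ∈ N`, as bounded operators. -/
def latticeOperators (a : ℕ) : Set (L2R →L[ℂ] L2R) :=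
  {S | ∃ n ∈ lattice a, S = (heis n : L2R →L[ℂ] L2R)}

/-- The von Neumann algebra `𝒜_N` of bounded `N`-periodic operators: the commutant of the
(self-adjoint) set of the operators `ρ(n, 1)`, `n ∈ N`. -/
def periodicAlgebra (a : ℕ) : VonNeumannAlgebra L2R where
  toStarSubalgebra := StarSubalgebra.centralizer ℂ (latticeOperators a)
  centralizer_centralizer' := by
    exact Set.centralizer_centralizer_centralizer _

theorem mem_periodicAlgebra_iff {a : ℕ} {T : L2R →L[ℂ] L2R} :
    T ∈ periodicAlgebra a ↔ ∀ n ∈ lattice a, ∀ φ, heis n (T ((heis n).symm φ)) = T φ := by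
  change T ∈ StarSubalgebra.centralizer ℂ (latticeOperators a) ↔ _
  rw [StarSubalgebra.mem_centralizer_iff]
  constructor
  · intro h n hn φ
    have h1 := DFunLike.congr_fun (h _ ⟨n, hn, rfl⟩).1 ((heis n).symm φ)
    simpa using h1
  · rintro h _ ⟨n, hn, rfl⟩
    have hs : star ((heis n : L2R →L[ℂ] L2R)) = ((heis n).symm : L2R →L[ℂ] L2R) := by
      rw [ContinuousLinearMap.star_eq_adjoint]
      exact (heis n).adjoint_eq_symm
    rw [hs]
    constructor
    · ext1 φ
      simpa using h n hn (heis n φ)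
    · ext1 φ
      have h2 := congrArg (heis n).symm (h n hn φ)
      simp only [LinearIsometryEquiv.symm_apply_apply] at h2
      exact h2.symm

/-- `χ_h`, the indicator function of `[h/a, (h+1)/a)`, as an element of `L²(ℝ)`. -/
def chi (a h : ℕ) : L2R :=
  indicatorConstLp 2 (measurableSet_Ico (a := (h / a : ℝ)) (b := ((h + 1) / a : ℝ)))
    (by simp) 1

/-- Linnell's trace `τ(T) = ∑_{h < a} ⟨T χ_h, χ_h⟩` on `𝒜_N` (the inner product of Mathlib is
conjugate-linear in the first variable). -/
def trace (a : ℕ) (T : periodicAlgebra a) : ℂ :=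
  ∑ h ∈ Finset.range a, ⟪chi a h, (T : L2R →L[ℂ] L2R) (chi a h)⟫_ℂ

/-! ### Spectral measures, the modulus of a closed operator, and `L¹(𝒜_N, τ)` -/

/-- A projection-valued measure on the Borel sets of `ℝ`, acting on `L²(ℝ)` (with the value `0` on
non-measurable sets). -/
structure ProjectionValuedMeasure where
  /-- The projection `E(s)`. -/
  proj : Set ℝ → L2R →L[ℂ] L2R
  isStarProjection : ∀ s, IsStarProjection (proj s)
  not_measurable : ∀ s, ¬ MeasurableSet s → proj s = 0
  empty : proj ∅ = 0
  univ : proj univ = 1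
  hasSum_iUnion : ∀ f : ℕ → Set ℝ, (∀ i, MeasurableSet (f i)) →
    Pairwise (Function.onFun Disjoint f) →
    ∀ φ, HasSum (fun i => proj (f i) φ) (proj (⋃ i, f i) φ)

theorem ProjectionValuedMeasure.re_inner_nonneg (E : ProjectionValuedMeasure) (s : Set ℝ)
    (φ : L2R) : 0 ≤ (⟪φ, E.proj s φ⟫_ℂ).re :=
  (ContinuousLinearMap.IsPositive.of_isStarProjection (E.isStarProjection s)).re_inner_nonneg_right φ

/-- The scalar measure `s ↦ ⟨E(s)φ, φ⟩` of a projection-valued measure. -/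
def ProjectionValuedMeasure.scalarMeasure (E : ProjectionValuedMeasure) (φ : L2R) : Measure ℝ :=
  Measure.ofMeasurable (fun s _ => ENNReal.ofReal (⟪φ, E.proj s φ⟫_ℂ).re)
    (by simp [E.empty])
    (by
      intro f hf hd
      have h1 : HasSum (fun i => (⟪φ, E.proj (f i) φ⟫_ℂ).re) (⟪φ, E.proj (⋃ i, f i) φ⟫_ℂ).re :=
        (((E.hasSum_iUnion f hf hd φ).mapL (innerSL ℂ φ)).mapL Complex.reCLM)
      rw [← h1.tsum_eq]
      exact ENNReal.ofReal_tsum_of_nonneg (fun i => E.re_inner_nonneg _ _) h1.summable)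

/-- `E` is the spectral measure of the self-adjoint operator `A`, that is `A = ∫ t dE(t)`: the
domain of `A` is `{φ | ∫ t² d⟨E(t)φ, φ⟩ < ∞}`, and `⟨Aφ, φ⟩ = ∫ t d⟨E(t)φ, φ⟩` on it. -/
structure IsSpectralMeasure (A : L2R →ₗ.[ℂ] L2R) (E : ProjectionValuedMeasure) : Prop where
  mem_domain_iff : ∀ φ, φ ∈ A.domain ↔ ∫⁻ t, ENNReal.ofReal (t ^ 2) ∂(E.scalarMeasure φ) < ∞
  inner_eq : ∀ φ : A.domain, ⟪(φ : L2R), A φ⟫_ℂ = ((∫ t, t ∂(E.scalarMeasure φ) : ℝ) : ℂ)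

/-- `A = |T|`: the positive self-adjoint operator with `A² = T* T`, where the equality of the two
composites of partially defined operators (on their natural domains) is that of their graphs. -/
structure IsModulus (T A : L2R →ₗ.[ℂ] L2R) : Prop where
  isSelfAdjoint : IsSelfAdjoint A
  nonneg : ∀ φ : A.domain, 0 ≤ (⟪(φ : L2R), A φ⟫_ℂ).re
  sq_eq : ∀ φ ψ : L2R, (∃ η, (φ, η) ∈ A.graph ∧ (η, ψ) ∈ A.graph) ↔
    ∃ η, (φ, η) ∈ T.graph ∧ (η, ψ) ∈ T.adjoint.graph

/-- `E` is the spectral measure of `|T|`, so that `E(s) = χ_s(|T|)` for Borel sets `s`. -/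
def IsModulusSpectralMeasure (T : L2R →ₗ.[ℂ] L2R) (E : ProjectionValuedMeasure) : Prop :=
  ∃ A, IsModulus T A ∧ IsSpectralMeasure A E

/-- The measure `s ↦ τ(E(s))`, for a projection-valued measure `E` with values in `𝒜_N`. -/
def traceMeasure (a : ℕ) (E : ProjectionValuedMeasure) (hE : ∀ s, E.proj s ∈ periodicAlgebra a) :
    Measure ℝ :=
  Measure.ofMeasurable (fun s _ => ENNReal.ofReal (trace a ⟨E.proj s, hE s⟩).re)
    (by simp [trace, E.empty])
    (by
      intro f hf hd
      have h0 : HasSum (fun i => trace a ⟨E.proj (f i), hE (f i)⟩)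
          (trace a ⟨E.proj (⋃ i, f i), hE (⋃ i, f i)⟩) :=
        hasSum_sum fun h _ => (E.hasSum_iUnion f hf hd (chi a h)).mapL (innerSL ℂ (chi a h))
      have h1 := h0.mapL Complex.reCLM
      simp only [Complex.reCLM_apply] at h1
      rw [← h1.tsum_eq]
      refine ENNReal.ofReal_tsum_of_nonneg (fun i => ?_) h1.summable
      rw [trace, Complex.re_sum]
      exact Finset.sum_nonneg fun h _ => E.re_inner_nonneg _ _)

/-- `T ∈ L¹(𝒜_N, τ)`: `T` is closed, densely defined and affiliated with `𝒜_N` (that is,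
`N`-periodic), and `τ(|T|) = ∫ t dτ(E(t)) < ∞`, where `E` is the spectral measure of `|T|`.
(As `τ` is finite, `τ`-measurability is automatic.) -/
def MemL1 (a : ℕ) (T : L2R →ₗ.[ℂ] L2R) : Prop :=
  IsPeriodic a T ∧ ∃ E, IsModulusSpectralMeasure T E ∧
    ∃ hE : ∀ s, E.proj s ∈ periodicAlgebra a,
      ∫⁻ t, ENNReal.ofReal t ∂(traceMeasure a E hE) < ∞

end

end ZakMultiplier

namespace ZakMultiplier

noncomputable section

/-! ### Multiplication by bounded functions -/

/-! Conjugation by the unitary `zak` turns `zakMultiplier g` into multiplication by `g` on L² of the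
square, where every assertion can be read off pointwise. The bridge is
`mem_graph_zakMultiplier_iff`: the graph is cut out by the a.e. equation Zψ = g·Zφ. Identities
between unbounded operators, domains included, thereby become pointwise identities between
multipliers.

Cutting φ off to bands where |g| is bounded gives density of the domain. Testing against truncated
functions shows that the adjoint is multiplication by the conjugate of g (`adjoint_zakMultiplier`).
So the operator is itself an adjoint, hence closed, and since ḡg = |g|² its modulus is
multiplication by |g|. The spectral measure of the modulus is s ↦ Z⁻¹ 1_{|g| ∈ s} Z
(`multiplierPVM`).

Periodicity holds because ρ(m, k) with integers m, k becomes multiplication by a unimodular function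
(`coeFn_zak_heis`), and multiplications commute.

Finally, Zχ_h is the indicator of a horizontal strip, and the a strips partition the square, so the
trace of Z⁻¹ 1_S Z is the measure of S (`trace_zakProj`). Hence τ ∘ E is the pushforward of Lebesgue
measure under |g|. This is the equality of distribution functions, and its first moment is ∫|g|,
finite by integrability. -/

theorem memLp_bdd_mul {u : ℝ × ℝ → ℂ} (hu : Measurable u) {C : ℝ} (hC : ∀ p, ‖u p‖ ≤ C)
    {F : ℝ × ℝ → ℂ} (hF : MemLp F 2 squareMeasure) :
    MemLp (fun p => u p * F p) 2 squareMeasure := by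
  refine hF.of_le_mul (c := C) (hu.aestronglyMeasurable.mul hF.aestronglyMeasurable)
    (ae_of_all _ fun p => ?_)
  rw [norm_mul]
  exact mul_le_mul_of_nonneg_right (hC p) (norm_nonneg _)

/-- Multiplication by a bounded measurable function, as a bounded operator on `L²([0,1)²)`. -/
def bddMul (u : ℝ × ℝ → ℂ) (hu : Measurable u) (C : ℝ) (hC : ∀ p, ‖u p‖ ≤ C) :
    L2Square →L[ℂ] L2Square :=
  LinearMap.mkContinuous
    { toFun := fun F => (memLp_bdd_mul hu hC (Lp.memLp F)).toLp _
      map_add' := fun F G => by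
        rw [← MemLp.toLp_add, MemLp.toLp_eq_toLp_iff]
        filter_upwards [Lp.coeFn_add F G] with p hp
        rw [hp]
        simp [mul_add]
      map_smul' := fun c F => by
        rw [RingHom.id_apply, ← MemLp.toLp_const_smul, MemLp.toLp_eq_toLp_iff]
        filter_upwards [Lp.coeFn_smul c F] with p hp
        rw [hp, Pi.smul_apply, Pi.smul_apply, smul_eq_mul, smul_eq_mul, mul_left_comm] }
    C
    (fun F => by
      refine Lp.norm_le_mul_norm_of_ae_le_mul ?_
      filter_upwards [MemLp.coeFn_toLp (memLp_bdd_mul hu hC (Lp.memLp F))] with p hp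
      change ‖(memLp_bdd_mul hu hC (Lp.memLp F)).toLp _ p‖ ≤ _
      rw [hp, norm_mul]
      exact mul_le_mul_of_nonneg_right (hC p) (norm_nonneg _))

theorem coeFn_bddMul (u : ℝ × ℝ → ℂ) (hu : Measurable u) (C : ℝ) (hC : ∀ p, ‖u p‖ ≤ C)
    (F : L2Square) : bddMul u hu C hC F =ᵐ[squareMeasure] fun p => u p * F p :=
  MemLp.coeFn_toLp (memLp_bdd_mul hu hC (Lp.memLp F))

/-! ### The graph of a Zak multiplier -/

theorem exists_zak_eq {F : ℝ × ℝ → ℂ} (hF : MemLp F 2 squareMeasure) :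
    ∃ φ : L2R, zak φ =ᵐ[squareMeasure] F :=
  ⟨zak.symm (hF.toLp F), by simpa using hF.coeFn_toLp⟩

theorem zak_ext {φ ψ : L2R} (h : zak φ =ᵐ[squareMeasure] zak ψ) : φ = ψ :=
  zak.injective (Lp.ext h)

theorem inner_eq_integral_zak (φ ψ : L2R) :
    ⟪φ, ψ⟫_ℂ = ∫ p, ⟪zak φ p, zak ψ p⟫_ℂ ∂squareMeasure := by
  rw [← zak.inner_map_map, L2.inner_def]

theorem coeFn_zak_zakMultiplier (g : ℝ × ℝ → ℂ) (φ : (zakMultiplier g).domain) :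
    zak (zakMultiplier g φ) =ᵐ[squareMeasure] fun p => g p * zak (φ : L2R) p := by
  have h : zak (zakMultiplier g φ) = mulZak g φ := zak.apply_symm_apply _
  rw [h]
  exact MemLp.coeFn_toLp (mem_zakMultiplierDomain.1 φ.2)

/-- The a.e. equation needs no separate domain condition: g·Zφ agrees a.e. with Zψ, which is already
in L². -/
theorem mem_graph_zakMultiplier_iff {g : ℝ × ℝ → ℂ} {φ ψ : L2R} :
    (φ, ψ) ∈ (zakMultiplier g).graph ↔
      zak ψ =ᵐ[squareMeasure] fun p => g p * zak φ p := by
  rw [LinearPMap.mem_graph_iff]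
  constructor
  · rintro ⟨y, rfl, rfl⟩
    exact coeFn_zak_zakMultiplier g y
  · intro h
    have hφ : φ ∈ (zakMultiplier g).domain :=
      mem_zakMultiplierDomain.2 ((Lp.memLp (zak ψ)).ae_eq h)
    exact ⟨⟨φ, hφ⟩, rfl, zak_ext ((coeFn_zak_zakMultiplier g ⟨φ, hφ⟩).trans h.symm)⟩

/-- Allows an a.e. measurable symbol to be replaced by a measurable one, whose level sets are
genuinely measurable. -/
theorem zakMultiplier_congr {g g' : ℝ × ℝ → ℂ} (h : g =ᵐ[squareMeasure] g') :
    zakMultiplier g = zakMultiplier g' := by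
  apply LinearPMap.eq_of_eq_graph
  ext ⟨φ, ψ⟩
  rw [mem_graph_zakMultiplier_iff, mem_graph_zakMultiplier_iff]
  have h' : (fun p => g p * zak φ p) =ᵐ[squareMeasure] fun p => g' p * zak φ p := by
    filter_upwards [h] with p hp
    rw [hp]
  exact ⟨fun h1 => h1.trans h', fun h1 => h1.trans h'.symm⟩

/-! ### Projections onto subsets of the unit square -/

/-- Multiplication by the indicator function of `S` after the Zak transform. -/
def zakProj (S : Set (ℝ × ℝ)) (hS : MeasurableSet S) : L2R →L[ℂ] L2R :=
  (zak.symm.toContinuousLinearEquiv : L2Square →L[ℂ] L2R) ∘L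
    bddMul (S.indicator 1) (measurable_one.indicator hS) 1
      (fun p => (norm_indicator_le_norm_self 1 p).trans (by simp)) ∘L
    (zak.toContinuousLinearEquiv : L2R →L[ℂ] L2Square)

theorem coeFn_zak_zakProj {S : Set (ℝ × ℝ)} (hS : MeasurableSet S) (φ : L2R) :
    zak (zakProj S hS φ) =ᵐ[squareMeasure] S.indicator (zak φ) := by
  have h : zak (zakProj S hS φ) = bddMul (S.indicator 1) (measurable_one.indicator hS) 1
      (fun p => (norm_indicator_le_norm_self 1 p).trans (by simp)) (zak φ) :=
    zak.apply_symm_apply _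
  rw [h]
  filter_upwards [coeFn_bddMul (S.indicator 1) (measurable_one.indicator hS) 1
    (fun p => (norm_indicator_le_norm_self 1 p).trans (by simp)) (zak φ)] with p hp
  rw [hp]
  by_cases hpS : p ∈ S <;> simp [hpS]

theorem inner_zakProj {S : Set (ℝ × ℝ)} (hS : MeasurableSet S) (φ : L2R) :
    ⟪φ, zakProj S hS φ⟫_ℂ = ((∫ p in S, ‖zak φ p‖ ^ 2 ∂squareMeasure : ℝ) : ℂ) := by
  rw [inner_eq_integral_zak, ← integral_complex_ofReal, ← integral_indicator hS]
  refine integral_congr_ae ?_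
  filter_upwards [coeFn_zak_zakProj hS φ] with p hp
  rw [hp]
  by_cases hpS : p ∈ S
  · simp [hpS, inner_self_eq_norm_sq_to_K]
  · simp [hpS]

theorem integrable_norm_zak_sq (φ : L2R) :
    Integrable (fun p => ‖zak φ p‖ ^ 2) squareMeasure :=
  (Lp.memLp (zak φ)).integrable_norm_pow two_ne_zero

theorem isStarProjection_zakProj {S : Set (ℝ × ℝ)} (hS : MeasurableSet S) :
    IsStarProjection (zakProj S hS) := by
  refine ⟨?_, ?_⟩
  · ext1 φ
    apply zak_ext
    rw [mul_apply_eq_comp]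
    filter_upwards [coeFn_zak_zakProj hS φ, coeFn_zak_zakProj hS (zakProj S hS φ)] with p h1 h2
    rw [h2, h1]
    by_cases hpS : p ∈ S <;> simp [hpS, h1]
  · rw [ContinuousLinearMap.isSelfAdjoint_iff_isSymmetric]
    intro φ ψ
    change ⟪zakProj S hS φ, ψ⟫_ℂ = ⟪φ, zakProj S hS ψ⟫_ℂ
    rw [inner_eq_integral_zak, inner_eq_integral_zak]
    refine integral_congr_ae ?_
    filter_upwards [coeFn_zak_zakProj hS φ, coeFn_zak_zakProj hS ψ] with p h1 h2
    rw [h1, h2]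
    by_cases hpS : p ∈ S <;> simp [hpS]

/-- The squared norm of the remainder after finitely many terms is the integral of |Zφ|² over the
sets left out, which tends to 0 by countable additivity of the integral. -/
theorem hasSum_zakProj {S : ℕ → Set (ℝ × ℝ)} (hS : ∀ i, MeasurableSet (S i))
    (hd : Pairwise (Function.onFun Disjoint S)) (φ : L2R) :
    HasSum (fun i => zakProj (S i) (hS i) φ)
      (zakProj (⋃ i, S i) (MeasurableSet.iUnion hS) φ) := by
  have hr : ∀ (T : Set (ℝ × ℝ)) (hT : MeasurableSet T),
      ‖zakProj T hT φ‖ ^ 2 = ∫ p in T, ‖zak φ p‖ ^ 2 ∂squareMeasure := by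
    intro T hT
    have hst := isStarProjection_zakProj hT
    have h1 : ⟪zakProj T hT φ, zakProj T hT φ⟫_ℂ = ⟪φ, zakProj T hT φ⟫_ℂ := by
      have h2 := (ContinuousLinearMap.isSelfAdjoint_iff_isSymmetric.1 hst.isSelfAdjoint)
        φ (zakProj T hT φ)
      have h3 := DFunLike.congr_fun hst.isIdempotentElem.eq φ
      rw [mul_apply_eq_comp] at h3
      change ⟪zakProj T hT φ, zakProj T hT φ⟫_ℂ = ⟪φ, zakProj T hT (zakProj T hT φ)⟫_ℂ at h2
      rw [h2, h3]
    rw [norm_sq_eq_re_inner (𝕜 := ℂ), h1, inner_zakProj]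
    exact Complex.ofReal_re _
  have hunion : ∀ s : Finset ℕ, MeasurableSet (⋃ i ∈ s, S i) := fun s =>
    s.measurableSet_biUnion fun i _ => hS i
  have hle : ∀ s : Finset ℕ, ⋃ i ∈ s, S i ⊆ ⋃ i, S i := fun s =>
    iUnion₂_subset fun i _ => subset_iUnion S i
  -- By disjointness, the remainder is again a projection of φ, onto the uncovered part of the
  -- union; `hr` then computes its norm.
  have hsub : ∀ s : Finset ℕ,
      zakProj (⋃ i, S i) (MeasurableSet.iUnion hS) φ - ∑ i ∈ s, zakProj (S i) (hS i) φ =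
        zakProj ((⋃ i, S i) \ ⋃ i ∈ s, S i) ((MeasurableSet.iUnion hS).diff (hunion s)) φ := by
    intro s
    apply zak_ext
    rw [map_sub, map_sum]
    have h1 : (∑ i ∈ s, zak (zakProj (S i) (hS i) φ) : L2Square) =ᵐ[squareMeasure]
        (⋃ i ∈ s, S i).indicator (zak φ) := by
      have h2 : (∑ i ∈ s, zak (zakProj (S i) (hS i) φ) : L2Square) =ᵐ[squareMeasure]
          fun p => ∑ i ∈ s, zak (zakProj (S i) (hS i) φ) p :=
        (Lp.coeFn_finsetSum _ _).trans (ae_of_all _ fun p => by simp)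
      have h3 := ae_all_iff.2 fun i => coeFn_zak_zakProj (hS i) φ
      filter_upwards [h2, h3] with p hp hp3
      rw [hp, Finset.indicator_biUnion_apply s S (fun i _ j _ hij => hd hij)]
      exact Finset.sum_congr rfl fun i _ => hp3 i
    filter_upwards [Lp.coeFn_sub (zak (zakProj (⋃ i, S i) (MeasurableSet.iUnion hS) φ))
      (∑ i ∈ s, zak (zakProj (S i) (hS i) φ)), h1,
      coeFn_zak_zakProj (MeasurableSet.iUnion hS) φ,
      coeFn_zak_zakProj ((MeasurableSet.iUnion hS).diff (hunion s)) φ] with p a1 a2 a3 a4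
    rw [a1, Pi.sub_apply, a2, a3, a4, Set.indicator_sdiff (hle s)]
    rfl
  have hsum := hasSum_integral_iUnion hS hd (integrable_norm_zak_sq φ).integrableOn
  rw [HasSum, SummationFilter.unconditional_filter, tendsto_iff_norm_sub_tendsto_zero]
  have hlim : Tendsto (fun s : Finset ℕ => Real.sqrt
      ((∫ p in ⋃ i, S i, ‖zak φ p‖ ^ 2 ∂squareMeasure) -
        ∑ i ∈ s, ∫ p in S i, ‖zak φ p‖ ^ 2 ∂squareMeasure)) atTop (nhds 0) := by
    have h1 := (tendsto_const_nhds (x := ∫ p in ⋃ i, S i, ‖zak φ p‖ ^ 2 ∂squareMeasure)).sub hsum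
    rw [sub_self] at h1
    simpa using h1.sqrt
  refine hlim.congr fun s => ?_
  rw [norm_sub_rev, hsub, ← Real.sqrt_sq (norm_nonneg _), hr,
    setIntegral_sdiff (hunion s) (integrable_norm_zak_sq φ).integrableOn (hle s),
    integral_biUnion_finset s (fun i _ => hS i) (fun i _ j _ hij => hd hij)
      fun i _ => (integrable_norm_zak_sq φ).integrableOn]

/-! ### The spectral measure of a real multiplier -/

open Classical in
/-- The projection-valued measure `s ↦ Z⁻¹ 1_{r ∈ s} Z` of a real measurable function `r`. -/
def multiplierPVM (r : ℝ × ℝ → ℝ) (hr : Measurable r) : ProjectionValuedMeasure where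
  proj s := if hs : MeasurableSet s then zakProj (r ⁻¹' s) (hr hs) else 0
  isStarProjection s := by
    split_ifs with hs
    · exact isStarProjection_zakProj (hr hs)
    · exact IsStarProjection.zero _
  not_measurable s hs := dif_neg hs
  empty := by
    rw [dif_pos MeasurableSet.empty]
    ext1 φ
    apply zak_ext
    filter_upwards [coeFn_zak_zakProj (hr MeasurableSet.empty) φ] with p h1
    rw [h1]
    simp
  univ := by
    rw [dif_pos MeasurableSet.univ]
    ext1 φ
    apply zak_ext
    filter_upwards [coeFn_zak_zakProj (hr MeasurableSet.univ) φ] with p h1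
    rw [h1]
    simp
  hasSum_iUnion f hf hd φ := by
    rw [dif_pos (MeasurableSet.iUnion hf)]
    simp only [hf, dite_true]
    convert hasSum_zakProj (fun i => hr (hf i)) (fun i j hij => (hd hij).preimage r) φ using 3
    exact preimage_iUnion

theorem multiplierPVM_proj {r : ℝ × ℝ → ℝ} (hr : Measurable r) {s : Set ℝ}
    (hs : MeasurableSet s) : (multiplierPVM r hr).proj s = zakProj (r ⁻¹' s) (hr hs) :=
  dif_pos hs

/-- Turns moments of the scalar spectral measure into integrals of powers of r against |Zφ|² on the
square. -/
theorem scalarMeasure_multiplierPVM {r : ℝ × ℝ → ℝ} (hr : Measurable r) (φ : L2R) :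
    (multiplierPVM r hr).scalarMeasure φ =
      (squareMeasure.withDensity fun p => ENNReal.ofReal (‖zak φ p‖ ^ 2)).map r := by
  ext s hs
  rw [ProjectionValuedMeasure.scalarMeasure, Measure.ofMeasurable_apply s hs,
    Measure.map_apply hr hs, withDensity_apply _ (hr hs), multiplierPVM_proj hr hs,
    inner_zakProj, Complex.ofReal_re,
    ofReal_integral_eq_lintegral_ofReal (integrable_norm_zak_sq φ).integrableOn
      (ae_of_all _ fun p => by positivity)]

/-! ### Domain, closedness and adjoint of a Zak multiplier -/

theorem memLp_mul_indicator {g : ℝ × ℝ → ℂ} (hg : Measurable g) {S : Set (ℝ × ℝ)}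
    (hS : MeasurableSet S) {C : ℝ} (hC : ∀ p ∈ S, ‖g p‖ ≤ C) {F : ℝ × ℝ → ℂ}
    (hF : MemLp F 2 squareMeasure) :
    MemLp (fun p => g p * S.indicator F p) 2 squareMeasure := by
  -- The absolute value covers empty S, where nothing forces C to be nonnegative.
  refine hF.of_le_mul (c := |C|)
    (hg.aestronglyMeasurable.mul (hF.aestronglyMeasurable.indicator hS)) (ae_of_all _ fun p => ?_)
  by_cases hp : p ∈ S
  · simp only [hp, indicator_of_mem, norm_mul]
    exact mul_le_mul_of_nonneg_right ((hC p hp).trans (le_abs_self C)) (norm_nonneg _)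
  · simp only [hp, not_false_eq_true, indicator_of_notMem, mul_zero, norm_zero]
    positivity

theorem dense_domain_zakMultiplier {g : ℝ × ℝ → ℂ} (hg : Measurable g) :
    Dense ((zakMultiplier g).domain : Set L2R) := by
  intro φ
  -- The bands ⌊|g|⌋₊ = n partition the square, and |g| ≤ n + 1 on the n-th. The partial sums of the
  -- resulting decomposition of φ lie in the domain and converge to φ.
  set f : ℕ → Set ℝ := fun n => {t | ⌊t⌋₊ = n} with hf
  have hfm : ∀ n, MeasurableSet (f n) := fun n => Nat.measurable_floor (measurableSet_singleton n)
  have hd : Pairwise (Function.onFun Disjoint f) := by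
    intro i j hij
    rw [Function.onFun, Set.disjoint_left]
    intro t hi hj
    exact hij (hi.symm.trans hj)
  have hU : ⋃ i, f i = univ := eq_univ_of_forall fun t => mem_iUnion.2 ⟨_, rfl⟩
  have hsum := (multiplierPVM (fun p => ‖g p‖) hg.norm).hasSum_iUnion f hfm hd φ
  rw [hU, (multiplierPVM (fun p => ‖g p‖) hg.norm).univ, one_apply_eq_self] at hsum
  refine mem_closure_of_tendsto hsum (Eventually.of_forall fun s => ?_)
  refine Submodule.sum_mem _ fun n _ => ?_
  rw [multiplierPVM_proj hg.norm (hfm n)]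
  refine (memLp_mul_indicator hg (hg.norm (hfm n)) (C := n + 1) (fun p hp => ?_)
    (Lp.memLp (zak φ))).ae_eq ?_
  · have h : ⌊‖g p‖⌋₊ = n := hp
    rw [← h]
    exact (Nat.lt_floor_add_one _).le
  · filter_upwards [coeFn_zak_zakProj (hg.norm (hfm n)) φ] with p hp
    rw [hp]

/-- The substantial inclusion is that an adjoint pair (x, y) satisfies Zy = ḡ·Zx a.e. Arbitrary test
functions may leave the domain, so the identity is proved on each set |g| ≤ n separately. -/
theorem adjoint_zakMultiplier {g : ℝ × ℝ → ℂ} (hg : Measurable g) :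
    (zakMultiplier g).adjoint = zakMultiplier fun p => (starRingEnd ℂ) (g p) := by
  apply LinearPMap.eq_of_eq_graph
  rw [LinearPMap.adjoint_graph_eq_graph_adjoint (dense_domain_zakMultiplier hg)]
  ext ⟨x, y⟩
  rw [Submodule.mem_adjoint_iff, mem_graph_zakMultiplier_iff]
  simp only [sub_eq_zero]
  constructor
  · intro h
    have key : ∀ n : ℕ, ∀ᵐ p ∂squareMeasure, ‖g p‖ ≤ n →
        zak y p = (starRingEnd ℂ) (g p) * zak x p := by
      intro n
      set S : Set (ℝ × ℝ) := {p | ‖g p‖ ≤ n} with hSdef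
      have hS : MeasurableSet S := measurableSet_le hg.norm measurable_const
      -- The test function is the defect ḡ·Zx − Zy itself, truncated to S so that both F and g·F are
      -- in L².
      set F : ℝ × ℝ → ℂ := fun p => (starRingEnd ℂ) (g p) * S.indicator (zak x) p -
        S.indicator (zak y) p with hF
      have hFm : MemLp F 2 squareMeasure :=
        (memLp_mul_indicator (Complex.continuous_conj.measurable.comp hg) hS (C := n)
          (fun p hp => (RCLike.norm_conj _).trans_le hp) (Lp.memLp (zak x))).sub
          ((Lp.memLp (zak y)).indicator hS)
      have hFS : S.indicator F = F := by
        rw [indicator_eq_self]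
        intro p hp
        by_contra hpS
        simp [hF, hpS] at hp
      have hgF : MemLp (fun p => g p * F p) 2 squareMeasure := by
        rw [← hFS]
        exact memLp_mul_indicator hg hS (C := n) (fun p hp => hp) hFm
      obtain ⟨u, hu⟩ := exists_zak_eq hFm
      obtain ⟨v, hv⟩ := exists_zak_eq hgF
      have h1 := h u v (mem_graph_zakMultiplier_iff.2 (by
        filter_upwards [hu, hv] with p a b
        rw [a, b]))
      rw [← sub_eq_zero, inner_eq_integral_zak, inner_eq_integral_zak,
        ← integral_sub (L2.integrable_inner _ _) (L2.integrable_inner _ _)] at h1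
      -- With Zu = F and Zv = g·F, the adjoint relation reads ∫ F̄(ḡ·Zx − Zy) = 0. As F vanishes off
      -- S, the integrand is |F|².
      have h2 : (∫ p, ‖F p‖ ^ 2 ∂squareMeasure) = 0 := by
        have h3 : ((∫ p, ‖F p‖ ^ 2 ∂squareMeasure : ℝ) : ℂ) = 0 := by
          rw [← h1, ← integral_complex_ofReal]
          refine integral_congr_ae ?_
          filter_upwards [hu, hv] with p a b
          rw [a, b]
          by_cases hpS : p ∈ S
          · have : F p = (starRingEnd ℂ) (g p) * zak x p - zak y p := by simp [hF, hpS]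
            have h5 := Complex.mul_conj (F p)
            rw [Complex.normSq_eq_norm_sq] at h5
            rw [← h5]
            nth_rewrite 1 [this]
            simp only [RCLike.inner_apply, map_mul]
            ring
          · have : F p = 0 := by simp [hF, hpS]
            simp [this]
        exact_mod_cast h3
      rw [integral_eq_zero_iff_of_nonneg (fun p => by positivity)
        (hFm.integrable_norm_pow two_ne_zero)] at h2
      filter_upwards [h2] with p hp hpn
      have hpS : p ∈ S := hpn
      have : F p = 0 := by simpa using hp
      simp only [hF, hpS, indicator_of_mem] at this
      exact (sub_eq_zero.1 this).symm
    filter_upwards [ae_all_iff.2 key] with p hp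
    obtain ⟨n, hn⟩ := exists_nat_ge ‖g p‖
    exact hp n hn
  · intro h u v huv
    rw [mem_graph_zakMultiplier_iff] at huv
    rw [inner_eq_integral_zak, inner_eq_integral_zak]
    refine integral_congr_ae ?_
    filter_upwards [h, huv] with p a b
    rw [a, b]
    simp only [RCLike.inner_apply, map_mul]
    ring

/-- The operator is the adjoint of the multiplier with conjugate symbol, and adjoints are closed. -/
theorem isClosed_zakMultiplier {g : ℝ × ℝ → ℂ} (hg : Measurable g) :
    (zakMultiplier g).IsClosed := by
  have hc : Measurable fun p => (starRingEnd ℂ) (g p) :=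
    Complex.continuous_conj.measurable.comp hg
  have h := LinearPMap.adjoint_isClosed (dense_domain_zakMultiplier hc)
  rw [adjoint_zakMultiplier hc] at h
  simpa using h

/-! ### The modulus of a Zak multiplier -/

theorem inner_zakMultiplier_ofReal (r : ℝ × ℝ → ℝ)
    (φ : (zakMultiplier fun p => (r p : ℂ)).domain) :
    ⟪(φ : L2R), zakMultiplier (fun p => (r p : ℂ)) φ⟫_ℂ =
      ((∫ p, r p * ‖zak (φ : L2R) p‖ ^ 2 ∂squareMeasure : ℝ) : ℂ) := by
  rw [inner_eq_integral_zak, ← integral_complex_ofReal]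
  refine integral_congr_ae ?_
  filter_upwards [coeFn_zak_zakMultiplier _ φ] with p hp
  rw [hp, RCLike.inner_apply, mul_assoc, Complex.mul_conj, Complex.normSq_eq_norm_sq]
  push_cast
  rfl

theorem isModulus_zakMultiplier {g : ℝ × ℝ → ℂ} (hg : Measurable g) :
    IsModulus (zakMultiplier g) (zakMultiplier fun p => (‖g p‖ : ℂ)) where
  isSelfAdjoint := by
    rw [LinearPMap.isSelfAdjoint_def, adjoint_zakMultiplier (by fun_prop)]
    simp
  nonneg φ := by
    rw [inner_zakMultiplier_ofReal, Complex.ofReal_re]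
    exact integral_nonneg fun p => by positivity
  sq_eq φ ψ := by
    have hsq : ∀ p, (starRingEnd ℂ) (g p) * g p = (‖g p‖ : ℂ) * ‖g p‖ := fun p => by
      rw [mul_comm, Complex.mul_conj, Complex.normSq_eq_norm_sq]
      push_cast
      ring
    rw [adjoint_zakMultiplier hg]
    simp only [mem_graph_zakMultiplier_iff]
    constructor
    · rintro ⟨η, h1, h2⟩
      -- The intermediate vector changes from |g|·Zφ to g·Zφ; both have the same absolute value, so
      -- one is in L² when the other is.
      have hm : MemLp (fun p => g p * zak φ p) 2 squareMeasure := by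
        refine (Lp.memLp (zak η)).congr_norm
          (hg.aestronglyMeasurable.mul (Lp.aestronglyMeasurable _)) ?_
        filter_upwards [h1] with p hp
        simp [hp]
      obtain ⟨ξ, hξ⟩ := exists_zak_eq hm
      refine ⟨ξ, hξ, ?_⟩
      filter_upwards [h1, h2, hξ] with p a b c
      rw [b, a, c, ← mul_assoc, ← mul_assoc, hsq]
    · rintro ⟨η, h1, h2⟩
      have hm : MemLp (fun p => (‖g p‖ : ℂ) * zak φ p) 2 squareMeasure := by
        refine (Lp.memLp (zak η)).congr_norm
          ((Complex.measurable_ofReal.comp hg.norm).aestronglyMeasurable.mul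
            (Lp.aestronglyMeasurable _)) ?_
        filter_upwards [h1] with p hp
        simp [hp]
      obtain ⟨ξ, hξ⟩ := exists_zak_eq hm
      refine ⟨ξ, hξ, ?_⟩
      filter_upwards [h1, h2, hξ] with p a b c
      rw [b, a, c, ← mul_assoc, ← mul_assoc, hsq]

theorem isSpectralMeasure_multiplierPVM {r : ℝ × ℝ → ℝ} (hr : Measurable r) :
    IsSpectralMeasure (zakMultiplier fun p => (r p : ℂ)) (multiplierPVM r hr) where
  mem_domain_iff φ := by
    rw [scalarMeasure_multiplierPVM, lintegral_map (by fun_prop) hr,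
      lintegral_withDensity_eq_lintegral_mul₀
        (integrable_norm_zak_sq φ).aestronglyMeasurable.aemeasurable.ennreal_ofReal (by fun_prop)]
    change MemLp (fun p => (r p : ℂ) * zak φ p) 2 squareMeasure ↔ _
    have hm : AEStronglyMeasurable (fun p => (r p : ℂ) * zak φ p) squareMeasure :=
      (Complex.measurable_ofReal.comp hr).aestronglyMeasurable.mul (Lp.aestronglyMeasurable _)
    rw [memLp_two_iff_integrable_sq_norm hm, Integrable,
      hasFiniteIntegral_iff_ofReal (ae_of_all _ fun p => by positivity)]
    rw [and_iff_right (by exact hm.norm.pow 2)]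
    refine iff_of_eq (congrArg (· < ∞) (lintegral_congr fun p => ?_))
    rw [Pi.mul_apply, ← ENNReal.ofReal_mul (by positivity)]
    congr 1
    simp [mul_pow, mul_comm]
  inner_eq φ := by
    rw [inner_zakMultiplier_ofReal, scalarMeasure_multiplierPVM,
      integral_map hr.aemeasurable (by fun_prop),
      integral_withDensity_eq_integral_toReal_smul₀
        (integrable_norm_zak_sq φ.1).aestronglyMeasurable.aemeasurable.ennreal_ofReal
        (ae_of_all _ fun p => ENNReal.ofReal_lt_top)]
    congr 1
    refine integral_congr_ae (ae_of_all _ fun p => ?_)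
    simp [mul_comm]

theorem isModulusSpectralMeasure_zakMultiplier {g : ℝ × ℝ → ℂ} (hg : Measurable g) :
    IsModulusSpectralMeasure (zakMultiplier g) (multiplierPVM (fun p => ‖g p‖) hg.norm) :=
  ⟨_, isModulus_zakMultiplier hg, isSpectralMeasure_multiplierPVM hg.norm⟩

/-! ### The Zak transform intertwines the lattice with multiplications -/

/-- The unimodular function by which `ρ(m, k)`, `m, k ∈ ℤ`, acts after the Zak transform. -/
def latticeFactor (m k : ℤ) (p : ℝ × ℝ) : ℂ :=
  Complex.exp (((Real.pi * (m * k + 2 * k * p.2 + 2 * m * p.1) : ℝ) : ℂ) * Complex.I)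

theorem norm_latticeFactor (m k : ℤ) (p : ℝ × ℝ) : ‖latticeFactor m k p‖ = 1 :=
  Complex.norm_exp_ofReal_mul_I _

theorem latticeFactor_ne_zero (m k : ℤ) (p : ℝ × ℝ) : latticeFactor m k p ≠ 0 :=
  Complex.exp_ne_zero _

theorem measurable_latticeFactor (m k : ℤ) : Measurable (latticeFactor m k) := by
  unfold latticeFactor
  exact Continuous.measurable (by fun_prop)

/-- Translation by m shifts the summation index by m, and the phases differ only by e^{-2πik(l+m)},
which is 1 for integers. -/
theorem zakTermFun_heisFun (m k l : ℤ) (φ : ℝ → ℂ) (p : ℝ × ℝ) :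
    zakTermFun (l + m) (heisFun m k φ) p = latticeFactor m k p * zakTermFun l φ p := by
  have h1 : p.2 - ((l + m : ℤ) : ℝ) + m = p.2 - l := by push_cast; ring
  rw [zakTermFun, heisFun, h1, latticeFactor, zakTermFun, mul_right_comm, ← Complex.exp_add,
    mul_comm _ (φ _), mul_left_comm, ← Complex.exp_add]
  congr 1
  refine Complex.exp_eq_exp_iff_exists_int.2 ⟨-(k * (l + m)), ?_⟩
  push_cast
  ring

/-- Multiplication by the unimodular factor is bounded, so it passes through the Zak series term by
term; reindexing by m absorbs the shift. -/
theorem coeFn_zak_heis (m k : ℤ) (φ : L2R) :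
    zak (heis ((m : ℝ), (k : ℝ)) φ) =ᵐ[squareMeasure] fun p => latticeFactor m k p * zak φ p := by
  set B := bddMul (latticeFactor m k) (measurable_latticeFactor m k) 1
    (fun p => (norm_latticeFactor m k p).le) with hB
  have hterm : ∀ l : ℤ, B (zakTerm l φ) = zakTerm (l + m) (heis ((m : ℝ), (k : ℝ)) φ) := by
    intro l
    apply Lp.ext
    filter_upwards [coeFn_bddMul (latticeFactor m k) (measurable_latticeFactor m k) 1
      (fun p => (norm_latticeFactor m k p).le) (zakTerm l φ), coeFn_zakTerm l φ,
      coeFn_zakTerm (l + m) (heis ((m : ℝ), (k : ℝ)) φ),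
      (qmp_shift (l + m)).ae_eq_comp (coeFn_heis ((m : ℝ), (k : ℝ)) φ)] with p h1 h2 h3 h4
    rw [h1, h2, h3, ← zakTermFun_heisFun]
    simp only [Function.comp_apply] at h4
    rw [zakTermFun, zakTermFun, h4]
  have h1 := (hasSum_zak φ).mapL B
  simp only [hterm] at h1
  have h2 := (Equiv.addRight m).hasSum_iff.2 (hasSum_zak (heis ((m : ℝ), (k : ℝ)) φ))
  rw [h2.unique h1]
  exact coeFn_bddMul _ _ _ _ _

/-- Since a is an integer, the lattice lies in ℤ², where the Zak transform diagonalises ρ. -/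
theorem exists_latticeFactor {a : ℕ} {w : ℝ × ℝ} (hw : w ∈ lattice a) :
    ∃ m k : ℤ, ∀ φ, zak (heis w φ) =ᵐ[squareMeasure] fun p => latticeFactor m k p * zak φ p := by
  obtain ⟨m, n, rfl⟩ := hw
  refine ⟨m, a * n, fun φ => ?_⟩
  have := coeFn_zak_heis m (a * n) φ
  push_cast at this
  exact this

theorem mem_graph_conjugate_iff {U : L2R ≃ₗᵢ[ℂ] L2R} {T : L2R →ₗ.[ℂ] L2R} {φ ψ : L2R} :
    (φ, ψ) ∈ (conjugate U T).graph ↔ (U.symm φ, U.symm ψ) ∈ T.graph := by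
  simp only [LinearPMap.mem_graph_iff]
  constructor
  · rintro ⟨y, rfl, rfl⟩
    exact ⟨⟨U.symm y, y.2⟩, rfl, (U.symm_apply_apply _).symm⟩
  · rintro ⟨y, hy, h⟩
    refine ⟨⟨φ, by change U.symm φ ∈ T.domain; rw [← hy]; exact y.2⟩, rfl, ?_⟩
    have hy' : y = ⟨U.symm φ, hy ▸ y.2⟩ := Subtype.ext hy
    rw [hy'] at h
    exact (U.symm_apply_eq.1 h.symm).symm

/-- The nonvanishing lattice factor multiplies both sides of the graph equation and cancels. -/
theorem conjugate_heis_zakMultiplier {a : ℕ} (g : ℝ × ℝ → ℂ) {w : ℝ × ℝ} (hw : w ∈ lattice a) :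
    conjugate (heis w) (zakMultiplier g) = zakMultiplier g := by
  obtain ⟨m, k, hmk⟩ := exists_latticeFactor hw
  apply LinearPMap.eq_of_eq_graph
  ext ⟨x, y⟩
  obtain ⟨φ, rfl⟩ := (heis w).surjective x
  obtain ⟨ψ, rfl⟩ := (heis w).surjective y
  rw [mem_graph_conjugate_iff, LinearIsometryEquiv.symm_apply_apply,
    LinearIsometryEquiv.symm_apply_apply, mem_graph_zakMultiplier_iff, mem_graph_zakMultiplier_iff]
  refine eventually_congr ?_
  filter_upwards [hmk φ, hmk ψ] with p h1 h2
  rw [h1, h2, mul_left_comm, mul_right_inj' (latticeFactor_ne_zero m k p)]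

theorem isPeriodic_zakMultiplier (a : ℕ) {g : ℝ × ℝ → ℂ} (hg : Measurable g) :
    IsPeriodic a (zakMultiplier g) :=
  ⟨dense_domain_zakMultiplier hg, isClosed_zakMultiplier hg,
    fun _ hw => conjugate_heis_zakMultiplier g hw⟩

theorem zakProj_mem_periodicAlgebra (a : ℕ) {S : Set (ℝ × ℝ)} (hS : MeasurableSet S) :
    zakProj S hS ∈ periodicAlgebra a := by
  rw [mem_periodicAlgebra_iff]
  intro w hw φ
  obtain ⟨m, k, hmk⟩ := exists_latticeFactor hw
  obtain ⟨ψ, rfl⟩ := (heis w).surjective φ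
  rw [LinearIsometryEquiv.symm_apply_apply]
  apply zak_ext
  filter_upwards [hmk ψ, hmk (zakProj S hS ψ), coeFn_zak_zakProj hS ψ,
    coeFn_zak_zakProj hS (heis w ψ)] with p h1 h2 h3 h4
  rw [h2, h3, h4]
  by_cases hpS : p ∈ S <;> simp [hpS, h1]

theorem multiplierPVM_mem_periodicAlgebra (a : ℕ) {r : ℝ × ℝ → ℝ} (hr : Measurable r)
    (s : Set ℝ) : (multiplierPVM r hr).proj s ∈ periodicAlgebra a := by
  by_cases hs : MeasurableSet s
  · rw [multiplierPVM_proj hr hs]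
    exact zakProj_mem_periodicAlgebra a _
  · rw [(multiplierPVM r hr).not_measurable s hs]
    exact zero_mem (periodicAlgebra a)

/-! ### The trace of a spectral projection -/

/-- The horizontal strip `ℝ × [h/a, (h+1)/a)`. -/
def strip (a h : ℕ) : Set (ℝ × ℝ) := Prod.snd ⁻¹' Ico (h / a : ℝ) ((h + 1) / a)

theorem measurableSet_strip (a h : ℕ) : MeasurableSet (strip a h) :=
  measurable_snd measurableSet_Ico

/-- Indexing strips by a floor makes it immediate that each point of the square lies in exactly one.
-/
theorem mem_strip_iff {a : ℕ} (ha : 0 < a) {h : ℕ} {p : ℝ × ℝ} (hp : p ∈ unitSquare) :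
    p ∈ strip a h ↔ ⌊p.2 * a⌋₊ = h := by
  have ha' : (0 : ℝ) < a := by exact_mod_cast ha
  rw [Nat.floor_eq_iff (mul_nonneg hp.2.1 ha'.le), strip, mem_preimage, mem_Ico,
    div_le_iff₀ ha', lt_div_iff₀ ha']

theorem floor_lt_of_mem_unitSquare {a : ℕ} (ha : 0 < a) {p : ℝ × ℝ} (hp : p ∈ unitSquare) :
    ⌊p.2 * a⌋₊ < a := by
  have ha' : (0 : ℝ) < a := by exact_mod_cast ha
  rw [Nat.floor_lt (mul_nonneg hp.2.1 ha'.le)]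
  exact mul_lt_of_lt_one_left ha' hp.2.2

theorem ae_mem_unitSquare : ∀ᵐ p ∂squareMeasure, p ∈ unitSquare :=
  ae_restrict_mem (measurableSet_Ico.prod measurableSet_Ico)

/-- The support of χ_h is inside [0, 1), so for σ in [0, 1) only the term l = 0 of the Zak series
survives, and its exponential is 1. -/
theorem coeFn_zak_chi {a h : ℕ} (hh : h < a) :
    zak (chi a h) =ᵐ[squareMeasure] (strip a h).indicator 1 := by
  have ha : (0 : ℝ) < a := by exact_mod_cast (Nat.zero_le h).trans_lt hh
  have hsub : Ico (h / a : ℝ) ((h + 1) / a) ⊆ Ico 0 1 := by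
    refine Ico_subset_Ico (by positivity) ?_
    rw [div_le_one ha]
    exact_mod_cast hh
  have hterm : ∀ l : ℤ, zakTerm l (chi a h) =ᵐ[squareMeasure]
      if l = 0 then (strip a h).indicator 1 else 0 := by
    intro l
    filter_upwards [coeFn_zakTerm l (chi a h), (qmp_shift l).ae_eq_comp
      (indicatorConstLp_coeFn (p := 2) (hs := measurableSet_Ico (a := (h / a : ℝ))
        (b := ((h + 1) / a : ℝ))) (hμs := by simp) (c := (1 : ℂ))), ae_mem_unitSquare]
      with p h1 h2 h3
    simp only [Function.comp_apply] at h2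
    rw [h1, zakTermFun, chi, h2]
    split_ifs with hl
    · subst hl
      by_cases hp : p.2 ∈ Ico (h / a : ℝ) ((h + 1) / a) <;> simp [hp, strip, indicator]
    · have : p.2 - l ∉ Ico (h / a : ℝ) ((h + 1) / a) := by
        intro h'
        have h4 := hsub h'
        have h5 := h3.2
        apply hl
        have h6 : (l : ℝ) < 1 := by linarith [h4.1, h5.2]
        have h7 : (-1 : ℝ) < l := by linarith [h4.2, h5.1]
        have h6' : l < 1 := by exact_mod_cast h6
        have h7' : -1 < l := by exact_mod_cast h7
        omega
      rw [indicator_of_notMem this, zero_mul, Pi.zero_apply]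
  have h0 : zak (chi a h) = zakTerm 0 (chi a h) := by
    refine (hasSum_zak (chi a h)).unique (hasSum_single 0 fun l hl => ?_)
    rw [Lp.eq_zero_iff_ae_eq_zero]
    simpa [hl] using hterm l
  rw [h0]
  simpa using hterm 0

/-- Each summand is the measure of S within one strip, because |Zχ_h|² is the strip's indicator; the
a strips partition the square. -/
theorem trace_zakProj {a : ℕ} (ha : 0 < a) {S : Set (ℝ × ℝ)} (hS : MeasurableSet S) :
    trace a ⟨zakProj S hS, zakProj_mem_periodicAlgebra a hS⟩ = (squareMeasure.real S : ℂ) := by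
  have h1 : ∀ h ∈ Finset.range a, ⟪chi a h, zakProj S hS (chi a h)⟫_ℂ =
      ((∫ p in S, (strip a h).indicator 1 p ∂squareMeasure : ℝ) : ℂ) := by
    intro h hh
    rw [inner_zakProj]
    congr 1
    refine integral_congr_ae (ae_restrict_of_ae ?_)
    filter_upwards [coeFn_zak_chi (Finset.mem_range.1 hh)] with p hp
    rw [hp]
    by_cases hps : p ∈ strip a h <;> simp [hps]
  change ∑ h ∈ Finset.range a, ⟪chi a h, zakProj S hS (chi a h)⟫_ℂ = _
  rw [Finset.sum_congr rfl h1, ← Complex.ofReal_sum, ← integral_finsetSum]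
  · congr 1
    rw [← setIntegral_one_eq_measureReal]
    refine integral_congr_ae (ae_restrict_of_ae ?_)
    filter_upwards [ae_mem_unitSquare] with p hp
    rw [Finset.sum_eq_single ⌊p.2 * a⌋₊]
    · rw [indicator_of_mem ((mem_strip_iff ha hp).2 rfl), Pi.one_apply]
    · intro h _ hne
      exact indicator_of_notMem (fun h' => hne ((mem_strip_iff ha hp).1 h').symm) _
    · intro hn
      exact absurd (Finset.mem_range.2 (floor_lt_of_mem_unitSquare ha hp)) hn
  · intro h _
    exact ((integrable_const (1 : ℝ)).indicator (measurableSet_strip a h)).integrableOn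

theorem trace_multiplierPVM {a : ℕ} (ha : 0 < a) {r : ℝ × ℝ → ℝ} (hr : Measurable r) {s : Set ℝ}
    (hs : MeasurableSet s) :
    trace a ⟨(multiplierPVM r hr).proj s, multiplierPVM_mem_periodicAlgebra a hr s⟩ =
      (squareMeasure.real (r ⁻¹' s) : ℂ) := by
  rw [← trace_zakProj ha (hr hs)]
  congr 2
  exact multiplierPVM_proj hr hs

theorem traceMeasure_multiplierPVM {a : ℕ} (ha : 0 < a) {r : ℝ × ℝ → ℝ} (hr : Measurable r) :
    traceMeasure a (multiplierPVM r hr) (multiplierPVM_mem_periodicAlgebra a hr) =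
      squareMeasure.map r := by
  ext s hs
  rw [traceMeasure, Measure.ofMeasurable_apply s hs, trace_multiplierPVM ha hr hs,
    Complex.ofReal_re, ofReal_measureReal, Measure.map_apply hr hs]

theorem memL1_zakMultiplier {a : ℕ} (ha : 0 < a) {g : ℝ × ℝ → ℂ} (hg : Measurable g)
    (hgi : Integrable g squareMeasure) : MemL1 a (zakMultiplier g) := by
  refine ⟨isPeriodic_zakMultiplier a hg, _, isModulusSpectralMeasure_zakMultiplier hg,
    multiplierPVM_mem_periodicAlgebra a hg.norm, ?_⟩
  rw [traceMeasure_multiplierPVM ha, lintegral_map (by fun_prop) hg.norm]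
  exact (hasFiniteIntegral_iff_norm g).1 hgi.2

end

end ZakMultiplier

theorem lemma4p1 (a : ℕ) (ha : 0 < a) (g : ℝ × ℝ → ℂ)
    (hg : IntegrableOn g ZakMultiplier.unitSquare volume) :
    Dense ((ZakMultiplier.zakMultiplier g).domain : Set ZakMultiplier.L2R) ∧
    (ZakMultiplier.zakMultiplier g).IsClosed ∧
    ZakMultiplier.IsPeriodic a (ZakMultiplier.zakMultiplier g) ∧
    ZakMultiplier.MemL1 a (ZakMultiplier.zakMultiplier g) ∧
    ∃ E, ZakMultiplier.IsModulusSpectralMeasure (ZakMultiplier.zakMultiplier g) E ∧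
      ∃ hE : ∀ s, E.proj s ∈ ZakMultiplier.periodicAlgebra a,
        ∀ t : ℝ, 0 < t →
          ZakMultiplier.trace a ⟨E.proj (Ioi t), hE (Ioi t)⟩ =
            ((volume.real {p ∈ ZakMultiplier.unitSquare | t < ‖g p‖} : ℝ) : ℂ) := by
  -- Integrability supplies only an a.e. representative that is measurable; the operator depends
  -- only on the a.e. class of its symbol.
  obtain ⟨f, hf, hgf⟩ := hg.aestronglyMeasurable
  have hfm := hf.measurable
  rw [ZakMultiplier.zakMultiplier_congr hgf]
  refine ⟨ZakMultiplier.dense_domain_zakMultiplier hfm, ZakMultiplier.isClosed_zakMultiplier hfm,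
    ZakMultiplier.isPeriodic_zakMultiplier a hfm,
    ZakMultiplier.memL1_zakMultiplier ha hfm (Integrable.congr hg hgf), _,
    ZakMultiplier.isModulusSpectralMeasure_zakMultiplier hfm,
    ZakMultiplier.multiplierPVM_mem_periodicAlgebra a hfm.norm, fun t _ => ?_⟩
  have hΩ : MeasurableSet ZakMultiplier.unitSquare := measurableSet_Ico.prod measurableSet_Ico
  rw [ZakMultiplier.trace_multiplierPVM ha hfm.norm measurableSet_Ioi,
    ZakMultiplier.squareMeasure, measureReal_restrict_apply' hΩ]
  congr 1
  refine measureReal_congr ?_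
  -- The level sets of f and g inside the square differ by a null set.
  filter_upwards [(ae_restrict_iff' hΩ).1 hgf] with p hp
  refine propext ⟨fun h => ⟨h.2, ?_⟩, fun h => ⟨?_, h.1⟩⟩
  · rw [hp h.2]
    exact h.1
  · change t < ‖f p‖
    rw [← hp h.1]
    exact h.2
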